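/- Let $p\ge 1$ and $\alpha,\beta>-1$ be real numbers and let $d\mu^{\alpha,\beta}(x)=(1-x)^{\alpha}(1+x)^{\beta}\,dx$ on $(-1,1)$. For an integer $\ell\ge 1$ and $\varpi=(\omega_0,\dots,\omega_{\ell-1})\in\mathbb{R}^{\ell}$ put $$\|f\|=\Big(\sum_{k=0}^{\ell-1}|f^{(k)}(\omega_k)|^p+\int_{-1}^{1}|f^{(\ell)}(x)|^p\,d\mu^{\alpha,\beta}(x)\Big)^{1/p}.$$ Let $W_{\varpi}$ be the completion of the space of real polynomials with respect to $\|\cdot\|$. Let $U_{\varpi}$ be the normed space of classes, under the relation $f\sim g\iff\|f-g\|=0$, of functions $f:\mathbb{R}\to\mathbb{R}$ such that (1) for $k=1,\dots,\ell-1$, $f$ has a derivative of order $k$ at $\omega_k$; (2) $f$ is $\ell-1$ times differentiable on $(-1,1)$ and $f^{(\ell-1)}$ is absolutely continuous on every compact subinterval of $(-1,1)$; (3) $f^{(\ell)}\in L^p(\mu^{\alpha,\beta})$. Write $W_{\varpi}=U_{\varpi}$ if there is a linear isometry of $U_{\varpi}$ onto $W_{\varpi}$ that sends the class of each polynomial to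 that polynomial. Then: 1. If $\ell=1$, then $W_{\omega_0}=U_{\omega_0}$ for every $\omega_0\in\mathbb{R}$. 2. If $\ell\ge 2$ and $p>1$, then $W_{\varpi}=U_{\varpi}$ for all $\varpi\in\mathbb{R}^{\ell}$ if and only if $\alpha,\beta\in(-1,p-1)$. 3. If $\ell\ge 2$ and $p=1$, then $W_{\varpi}=U_{\varpi}$ for all $\varpi\in\mathbb{R}^{\ell}$ if and only if $\alpha,\beta\in(-1,0]$. -/

import Mathlib

open MeasureTheory Set Filter Topology Polynomial

namespace JacobiSobolev

noncomputable section

/-- The Jacobi measure `(1-x)^α (1+x)^β dx` on `(-1,1)` (the endpoints are Lebesgue-null). -/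
def jacobiMeasure (α β : ℝ) : Measure ℝ :=
  (volume.restrict (Ioo (-1 : ℝ) 1)).withDensity
    fun x => ENNReal.ofReal ((1 - x) ^ α * (1 + x) ^ β)

/-- `DiffAtOrder k f x`: the function `f` has a derivative of order `k` at `x`, i.e. it is `k-1`
times differentiable in a neighbourhood of `x` and its derivative of order `k-1` is
differentiable at `x`. -/
def DiffAtOrder : ℕ → (ℝ → ℝ) → ℝ → Prop
  | 0, _, _ => True
  | k + 1, f, x =>
      (∀ᶠ y in 𝓝 x, DiffAtOrder k f y) ∧ DifferentiableAt ℝ (iteratedDeriv k f) x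

/-- The norm `(∑_{k<ℓ} |f^{(k)}(ω_k)|^p + ∫_{-1}^1 |f^{(ℓ)}|^p dμ^{α,β})^{1/p}`. -/
def jsNorm (p α β : ℝ) (ℓ : ℕ) (ω : Fin ℓ → ℝ) (f : ℝ → ℝ) : ℝ :=
  ((∑ k : Fin ℓ, |iteratedDeriv k f (ω k)| ^ p) +
    ∫ x, |iteratedDeriv ℓ f x| ^ p ∂(jacobiMeasure α β)) ^ (1 / p)

/-- The conditions that define the function space: existence of the `k`-th derivative at `ω_k`,
`ℓ-1` times differentiability on `(-1,1)` with `f^{(ℓ-1)}` absolutely continuous on the compact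
subintervals of `(-1,1)`, and `f^{(ℓ)} ∈ L^p(μ^{α,β})`. -/
structure IsSuitable (p α β : ℝ) (ℓ : ℕ) (ω : Fin ℓ → ℝ) (f : ℝ → ℝ) : Prop where
  diffAt_node : ∀ k : Fin ℓ, DiffAtOrder k f (ω k)
  diffAt_interior : ∀ x ∈ Ioo (-1 : ℝ) 1, DiffAtOrder (ℓ - 1) f x
  absCont : ∀ a b : ℝ, -1 < a → a ≤ b → b < 1 →
    AbsolutelyContinuousOnInterval (iteratedDeriv (ℓ - 1) f) a b
  memLp : MemLp (iteratedDeriv ℓ f) (ENNReal.ofReal p) (jacobiMeasure α β)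

theorem DiffAtOrder.add {k : ℕ} {f g : ℝ → ℝ} {x : ℝ} (hf : DiffAtOrder k f x)
    (hg : DiffAtOrder k g x) : DiffAtOrder k (f + g) x ∧
      iteratedDeriv k (f + g) x = iteratedDeriv k f x + iteratedDeriv k g x := by
  induction k generalizing x with
  | zero => exact ⟨trivial, by simp⟩
  | succ k ih =>
    have h := hf.1.and hg.1
    have heq : iteratedDeriv k (f + g) =ᶠ[𝓝 x] iteratedDeriv k f + iteratedDeriv k g := by
      filter_upwards [h] with y hy
      exact (ih hy.1 hy.2).2
    refine ⟨⟨?_, ?_⟩, ?_⟩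
    · filter_upwards [h] with y hy
      exact (ih hy.1 hy.2).1
    · exact (hf.2.add hg.2).congr_of_eventuallyEq heq
    · rw [iteratedDeriv_succ, iteratedDeriv_succ, iteratedDeriv_succ, heq.deriv_eq,
        deriv_add hf.2 hg.2]

theorem iteratedDeriv_smul' (k : ℕ) (c : ℝ) (f : ℝ → ℝ) :
    iteratedDeriv k (c • f) = c • iteratedDeriv k f := by
  funext x
  simp

theorem DiffAtOrder.smul {k : ℕ} {f : ℝ → ℝ} {x : ℝ} (c : ℝ) (hf : DiffAtOrder k f x) :
    DiffAtOrder k (c • f) x := by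
  induction k generalizing x with
  | zero => trivial
  | succ k ih =>
    refine ⟨hf.1.mono fun y hy => ih hy, ?_⟩
    rw [iteratedDeriv_smul']
    exact hf.2.const_smul c

theorem jacobiMeasure_ac (α β : ℝ) :
    jacobiMeasure α β ≪ volume.restrict (Ioo (-1 : ℝ) 1) :=
  withDensity_absolutelyContinuous _ _

namespace IsSuitable

variable {p α β : ℝ} {ℓ : ℕ} {ω : Fin ℓ → ℝ} {f g : ℝ → ℝ}

theorem ae_differentiableAt (hf : IsSuitable p α β ℓ ω f) :
    ∀ᵐ x ∂(volume.restrict (Ioo (-1 : ℝ) 1)),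
      DifferentiableAt ℝ (iteratedDeriv (ℓ - 1) f) x := by
  rw [ae_restrict_iff' measurableSet_Ioo]
  have h : ∀ n : ℕ, ∀ᵐ x : ℝ, x ∈ uIcc (-1 + 1 / ((n : ℝ) + 1)) (1 - 1 / ((n : ℝ) + 1)) →
      x ∈ Icc (-1 + 1 / ((n : ℝ) + 1)) (1 - 1 / ((n : ℝ) + 1)) →
      DifferentiableAt ℝ (iteratedDeriv (ℓ - 1) f) x := by
    intro n
    have hn : 0 < 1 / ((n : ℝ) + 1) := by positivity
    by_cases hle : -1 + 1 / ((n : ℝ) + 1) ≤ 1 - 1 / ((n : ℝ) + 1)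
    · filter_upwards [(hf.absCont _ _ (by linarith) hle (by linarith)).ae_differentiableAt]
        with x hx h1 _
      exact hx h1
    · filter_upwards with x _ h2
      exact absurd (h2.1.trans h2.2) hle
  filter_upwards [ae_all_iff.2 h] with x hx hx1
  obtain ⟨n, hn⟩ := exists_nat_one_div_lt (lt_min (show 0 < x + 1 by linarith [hx1.1])
    (show 0 < 1 - x by linarith [hx1.2]))
  have h1 := hn.trans_le (min_le_left _ _)
  have h2 := hn.trans_le (min_le_right _ _)
  have h3 : x ∈ Icc (-1 + 1 / ((n : ℝ) + 1)) (1 - 1 / ((n : ℝ) + 1)) :=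
    ⟨by linarith, by linarith⟩
  exact hx n (Icc_subset_uIcc h3) h3

theorem ae_iteratedDeriv_add (hf : IsSuitable p α β ℓ ω f) (hg : IsSuitable p α β ℓ ω g) :
    iteratedDeriv ℓ (f + g) =ᵐ[jacobiMeasure α β] iteratedDeriv ℓ f + iteratedDeriv ℓ g := by
  apply (jacobiMeasure_ac α β).ae_eq
  filter_upwards [hf.ae_differentiableAt, hg.ae_differentiableAt,
    ae_restrict_mem measurableSet_Ioo] with x h1 h2 hx
  cases ℓ with
  | zero => simp
  | succ n =>
    have hev : ∀ᶠ y in 𝓝 x, y ∈ Ioo (-1 : ℝ) 1 := isOpen_Ioo.mem_nhds hx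
    exact (DiffAtOrder.add (k := n + 1) (x := x)
      ⟨hev.mono fun y hy => hf.diffAt_interior y hy, h1⟩
      ⟨hev.mono fun y hy => hg.diffAt_interior y hy, h2⟩).2

theorem add (hf : IsSuitable p α β ℓ ω f) (hg : IsSuitable p α β ℓ ω g) :
    IsSuitable p α β ℓ ω (f + g) where
  diffAt_node k := ((hf.diffAt_node k).add (hg.diffAt_node k)).1
  diffAt_interior x hx := ((hf.diffAt_interior x hx).add (hg.diffAt_interior x hx)).1
  absCont a b ha hab hb := by
    refine ((hf.absCont a b ha hab hb).add (hg.absCont a b ha hab hb)).congr' ?_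
    refine Filter.eventuallyEq_of_mem (mem_inf_of_right (mem_principal_self _)) ?_
    rintro ⟨n, I⟩ hI
    refine Finset.sum_congr rfl fun i hi => ?_
    have hsub : ∀ y ∈ uIcc a b, iteratedDeriv (ℓ - 1) (f + g) y =
        iteratedDeriv (ℓ - 1) f y + iteratedDeriv (ℓ - 1) g y := by
      intro y hy
      rw [uIcc_of_le hab] at hy
      have hy' : y ∈ Ioo (-1 : ℝ) 1 := ⟨by linarith [hy.1], by linarith [hy.2]⟩
      exact ((hf.diffAt_interior y hy').add (hg.diffAt_interior y hy')).2
    have := hI.1 i hi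
    simp only [Pi.add_apply]
    rw [hsub _ this.1, hsub _ this.2]
  memLp := (hf.memLp.add hg.memLp).ae_eq (hf.ae_iteratedDeriv_add hg).symm

theorem smul (c : ℝ) (hf : IsSuitable p α β ℓ ω f) : IsSuitable p α β ℓ ω (c • f) where
  diffAt_node k := (hf.diffAt_node k).smul c
  diffAt_interior x hx := (hf.diffAt_interior x hx).smul c
  absCont a b ha hab hb := by
    rw [iteratedDeriv_smul']
    exact (hf.absCont a b ha hab hb).const_mul c
  memLp := by
    rw [iteratedDeriv_smul']
    exact hf.memLp.const_smul c

theorem integral_eq (hp : 1 ≤ p) (hf : IsSuitable p α β ℓ ω f) :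
    ∫ x, |iteratedDeriv ℓ f x| ^ p ∂(jacobiMeasure α β) =
      |lpNorm (iteratedDeriv ℓ f) (ENNReal.ofReal p) (jacobiMeasure α β)| ^ p := by
  have hp0 : 0 < p := by linarith
  rw [abs_of_nonneg lpNorm_nonneg, lpNorm_eq_integral_norm_rpow_toReal (by simpa using hp0)
    ENNReal.ofReal_ne_top hf.memLp.1, ENNReal.toReal_ofReal hp0.le,
    Real.rpow_inv_rpow _ hp0.ne']
  · rfl
  · exact integral_nonneg fun x => by positivity

theorem jsNorm_eq (hp : 1 ≤ p) (hf : IsSuitable p α β ℓ ω f) :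
    jsNorm p α β ℓ ω f = (∑ i : Option (Fin ℓ), |i.elim
      (lpNorm (iteratedDeriv ℓ f) (ENNReal.ofReal p) (jacobiMeasure α β))
      (fun k => iteratedDeriv k f (ω k))| ^ p) ^ (1 / p) := by
  rw [jsNorm, hf.integral_eq hp, Fintype.sum_option, add_comm]
  rfl

theorem jsNorm_add_le (hp : 1 ≤ p) (hf : IsSuitable p α β ℓ ω f)
    (hg : IsSuitable p α β ℓ ω g) :
    jsNorm p α β ℓ ω (f + g) ≤ jsNorm p α β ℓ ω f + jsNorm p α β ℓ ω g := by
  rw [(hf.add hg).jsNorm_eq hp, hf.jsNorm_eq hp, hg.jsNorm_eq hp]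
  refine le_trans ?_ (Real.Lp_add_le _ _ _ hp)
  refine Real.rpow_le_rpow (by positivity) (Finset.sum_le_sum fun i _ => ?_)
    (by have : 0 < p := by linarith
        positivity)
  cases i with
  | none =>
    refine Real.rpow_le_rpow (abs_nonneg _) (abs_le_abs_of_nonneg lpNorm_nonneg ?_)
      (by linarith)
    have hp1 : 1 ≤ ENNReal.ofReal p := by simpa using hp
    have h : lpNorm (iteratedDeriv ℓ (f + g)) (ENNReal.ofReal p) (jacobiMeasure α β) =
        lpNorm (iteratedDeriv ℓ f + iteratedDeriv ℓ g) (ENNReal.ofReal p)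
          (jacobiMeasure α β) := by
      rw [← toReal_eLpNorm (hf.add hg).memLp.1, ← toReal_eLpNorm (hf.memLp.add hg.memLp).1,
        eLpNorm_congr_ae (hf.ae_iteratedDeriv_add hg)]
    exact h.trans_le (lpNorm_add_le hf.memLp hp1)
  | some k =>
    simp only [Option.elim]
    rw [((hf.diffAt_node k).add (hg.diffAt_node k)).2]

end IsSuitable

theorem jsNorm_smul {p : ℝ} (hp : 1 ≤ p) (α β : ℝ) {ℓ : ℕ} (ω : Fin ℓ → ℝ) (c : ℝ)
    (f : ℝ → ℝ) : jsNorm p α β ℓ ω (c • f) = ‖c‖ * jsNorm p α β ℓ ω f := by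
  have hp0 : 0 < p := by linarith
  simp only [jsNorm, iteratedDeriv_smul', Pi.smul_apply, smul_eq_mul, abs_mul,
    Real.mul_rpow (abs_nonneg _) (abs_nonneg _), ← Finset.mul_sum, integral_const_mul,
    ← mul_add]
  rw [Real.mul_rpow (by positivity)
    (add_nonneg (by positivity) (integral_nonneg fun x => by positivity)),
    one_div, Real.rpow_rpow_inv (abs_nonneg _) hp0.ne', Real.norm_eq_abs]

theorem jsNorm_nonneg (p α β : ℝ) {ℓ : ℕ} (ω : Fin ℓ → ℝ) (f : ℝ → ℝ) :
    0 ≤ jsNorm p α β ℓ ω f :=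
  Real.rpow_nonneg (add_nonneg (Finset.sum_nonneg fun _ _ => by positivity)
    (integral_nonneg fun x => by positivity)) _

/-! ### Polynomials are suitable -/

theorem iteratedDeriv_eval (k : ℕ) (P : ℝ[X]) :
    iteratedDeriv k (fun x => P.eval x) = fun x => (derivative^[k] P).eval x := by
  induction k with
  | zero => simp
  | succ k ih =>
    rw [iteratedDeriv_succ, ih, Function.iterate_succ_apply']
    funext x
    simp

theorem diffAtOrder_eval (k : ℕ) (P : ℝ[X]) (x : ℝ) :
    DiffAtOrder k (fun x => P.eval x) x := by
  induction k generalizing x with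
  | zero => trivial
  | succ k ih =>
    refine ⟨Eventually.of_forall ih, ?_⟩
    rw [iteratedDeriv_eval]
    exact Polynomial.differentiableAt _

theorem isFiniteMeasure_jacobiMeasure {α β : ℝ} (hα : -1 < α) (hβ : -1 < β) :
    IsFiniteMeasure (jacobiMeasure α β) := by
  have h1 : IntervalIntegrable (fun x : ℝ => (1 - x) ^ α * (1 + x) ^ β) volume (-1) 0 := by
    have h : IntervalIntegrable (fun x : ℝ => (1 + x) ^ β) volume (-1) 0 := by
      simpa using (intervalIntegral.intervalIntegrable_rpow' (a := 0) (b := 1) hβ).comp_add_left 1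
    refine h.continuousOn_mul ?_
    refine ContinuousOn.rpow_const (by fun_prop) fun x hx => Or.inl ?_
    rw [uIcc_of_le (by norm_num)] at hx
    linarith [hx.2]
  have h2 : IntervalIntegrable (fun x : ℝ => (1 - x) ^ α * (1 + x) ^ β) volume 0 1 := by
    have h : IntervalIntegrable (fun x : ℝ => (1 - x) ^ α) volume 0 1 := by
      simpa using
        (intervalIntegral.intervalIntegrable_rpow' (a := 1) (b := 0) hα).comp_sub_left 1
    refine h.mul_continuousOn ?_
    refine ContinuousOn.rpow_const (by fun_prop) fun x hx => Or.inl ?_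
    rw [uIcc_of_le (by norm_num)] at hx
    linarith [hx.1]
  have h3 := h1.trans h2
  rw [intervalIntegrable_iff_integrableOn_Ioo_of_le (by norm_num)] at h3
  exact isFiniteMeasure_withDensity_ofReal h3.2

theorem isSuitable_eval {p α β : ℝ} (hα : -1 < α) (hβ : -1 < β) {ℓ : ℕ}
    (ω : Fin ℓ → ℝ) (P : ℝ[X]) : IsSuitable p α β ℓ ω (fun x => P.eval x) where
  diffAt_node k := diffAtOrder_eval k P _
  diffAt_interior x _ := diffAtOrder_eval _ P x
  absCont a b _ _ _ := by
    rw [iteratedDeriv_eval]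
    have h : ContDiff ℝ 1 fun x => Polynomial.eval x (derivative^[ℓ - 1] P) := by
      simpa using Polynomial.contDiff_aeval (𝕜 := ℝ) (derivative^[ℓ - 1] P) 1
    exact h.contDiffOn.absolutelyContinuousOnInterval
  memLp := by
    have := isFiniteMeasure_jacobiMeasure hα hβ
    rw [iteratedDeriv_eval]
    obtain ⟨C, hC⟩ := (isCompact_Icc (a := (-1 : ℝ)) (b := 1)).exists_bound_of_continuousOn
      (Polynomial.continuous (derivative^[ℓ] P)).continuousOn
    refine MemLp.of_bound (Polynomial.continuous _).aestronglyMeasurable C ?_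
    refine (jacobiMeasure_ac α β).ae_le ?_
    filter_upwards [ae_restrict_mem measurableSet_Ioo] with x hx
    exact hC x (Ioo_subset_Icc_self hx)

/-! ### The seminormed space of suitable functions and the space `U` -/

/-- The suitable functions, as a linear subspace of the space of all functions `ℝ → ℝ`. -/
def suitableSubmodule (p α β : ℝ) (ℓ : ℕ) (ω : Fin ℓ → ℝ) :
    Submodule ℝ (ℝ → ℝ) where
  carrier := {f | IsSuitable p α β ℓ ω f}
  add_mem' hf hg := hf.add hg
  zero_mem' := by
    have h0 : (0 : ℝ → ℝ) = fun x => (0 : ℝ[X]).eval x := by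
      funext x
      simp
    refine ⟨fun k => ?_, fun x _ => ?_, fun a b _ _ _ => ?_, ?_⟩
    · rw [h0]
      exact diffAtOrder_eval k (0 : ℝ[X]) (ω k)
    · rw [h0]
      exact diffAtOrder_eval (ℓ - 1) (0 : ℝ[X]) x
    · have h : iteratedDeriv (ℓ - 1) (0 : ℝ → ℝ) = fun _ => 0 := by
        funext x; exact iteratedDeriv_const_zero
      rw [h]
      exact contDiff_const.contDiffOn.absolutelyContinuousOnInterval
    · have h : iteratedDeriv ℓ (0 : ℝ → ℝ) = fun _ => 0 := by
        funext x; exact iteratedDeriv_const_zero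
      rw [h]
      exact MemLp.zero'
  smul_mem' c _ hf := hf.smul c

/-- The linear space of suitable functions, seminormed by `jsNorm`. (A type of its own, so that
it does not carry the topology of pointwise convergence.) -/
def SuitableFun (p α β : ℝ) (ℓ : ℕ) (ω : Fin ℓ → ℝ) : Type :=
  ↥(suitableSubmodule p α β ℓ ω)

/-- The linear space of real polynomials, to be normed by `jsNorm`. -/
def PolySpace (_p _α _β : ℝ) (ℓ : ℕ) (_ω : Fin ℓ → ℝ) : Type := ℝ[X]

section Spaces

variable (p α β : ℝ) (ℓ : ℕ) (ω : Fin ℓ → ℝ)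

instance : AddCommGroup (SuitableFun p α β ℓ ω) :=
  inferInstanceAs (AddCommGroup ↥(suitableSubmodule p α β ℓ ω))

instance : Module ℝ (SuitableFun p α β ℓ ω) :=
  inferInstanceAs (Module ℝ ↥(suitableSubmodule p α β ℓ ω))

instance : Norm (SuitableFun p α β ℓ ω) := ⟨fun f => jsNorm p α β ℓ ω f.1⟩

instance : AddCommGroup (PolySpace p α β ℓ ω) := inferInstanceAs (AddCommGroup ℝ[X])

instance : Module ℝ (PolySpace p α β ℓ ω) := inferInstanceAs (Module ℝ ℝ[X])

instance : Norm (PolySpace p α β ℓ ω) :=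
  ⟨fun P => jsNorm p α β ℓ ω fun x => Polynomial.eval x (show ℝ[X] from P)⟩

variable [hp : Fact (1 ≤ p)]

theorem suitableFun_core : SeminormedSpace.Core ℝ (SuitableFun p α β ℓ ω) where
  norm_nonneg f := jsNorm_nonneg p α β ω f.1
  norm_smul c f := jsNorm_smul hp.out α β ω c f.1
  norm_triangle f g := f.2.jsNorm_add_le hp.out g.2

instance : SeminormedAddCommGroup (SuitableFun p α β ℓ ω) :=
  SeminormedAddCommGroup.ofCore (suitableFun_core p α β ℓ ω)

instance : NormedSpace ℝ (SuitableFun p α β ℓ ω) where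
  norm_smul_le c f := (jsNorm_smul hp.out α β ω c f.1).le

/-- The space `U`: suitable functions modulo `f ∼ g` iff `‖f - g‖ = 0`, with the quotient norm
`‖[f]‖ = ‖f‖`. -/
abbrev U : Type := SeparationQuotient (SuitableFun p α β ℓ ω)

variable [hα : Fact (-1 < α)] [hβ : Fact (-1 < β)]

/-- A polynomial, as a suitable function. -/
def polyToFun (P : PolySpace p α β ℓ ω) : SuitableFun p α β ℓ ω :=
  ⟨fun x => Polynomial.eval x (show ℝ[X] from P), isSuitable_eval hα.out hβ.out ω P⟩

theorem polySpace_core : SeminormedSpace.Core ℝ (PolySpace p α β ℓ ω) where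
  norm_nonneg P := jsNorm_nonneg p α β ω _
  norm_smul c P := by
    have h : polyToFun p α β ℓ ω (c • P) = c • polyToFun p α β ℓ ω P :=
      Subtype.ext (funext fun x => Polynomial.eval_smul (x := x) c (show ℝ[X] from P))
    exact (congrArg norm h).trans (jsNorm_smul hp.out α β ω c _)
  norm_triangle P Q := by
    have h : polyToFun p α β ℓ ω (P + Q) = polyToFun p α β ℓ ω P + polyToFun p α β ℓ ω Q :=
      Subtype.ext (funext fun x =>
        Polynomial.eval_add (x := x) (p := (show ℝ[X] from P)) (q := (show ℝ[X] from Q)))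
    exact (congrArg norm h).trans_le
      ((suitableFun_core p α β ℓ ω).norm_triangle _ _)

instance : SeminormedAddCommGroup (PolySpace p α β ℓ ω) :=
  SeminormedAddCommGroup.ofCore (polySpace_core p α β ℓ ω)

instance : NormedSpace ℝ (PolySpace p α β ℓ ω) where
  norm_smul_le c P := ((polySpace_core p α β ℓ ω).norm_smul c P).le

/-- The space `W`: the completion of the polynomials with respect to `jsNorm`, i.e. the classes of
Cauchy sequences of polynomials modulo sequences whose difference has norm tending to `0`. -/
abbrev W : Type := UniformSpace.Completion (PolySpace p α β ℓ ω)

/-- `W = U`: there is a linear isometry of `U` onto `W` which carries the class of every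
polynomial in `U` to the same polynomial in `W`. (Such an isometry necessarily sends the class of
`f` to the class of any sequence of polynomials that converges to `f` in norm.) -/
def WEqU : Prop :=
  ∃ e : U p α β ℓ ω ≃ₗᵢ[ℝ] W p α β ℓ ω,
    ∀ P : PolySpace p α β ℓ ω,
      e (SeparationQuotient.mk (polyToFun p α β ℓ ω P)) = (P : W p α β ℓ ω)

end Spaces

end

end JacobiSobolev

namespace JacobiSobolev

noncomputable section

/-! A suitable function is recorded by its nodal values `f^{(k)}(ω_k)` and by the class of `f^{(ℓ)}`
in `L^p(μ)`. This linear map `dataMap` into the Banach space `ℝ^ℓ × L^p(μ)` compares the seminorm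
with the product norm up to constants. Polynomials have dense image, because they realise any nodal
values exactly and their `ℓ`-th derivatives are dense in `L^p(μ)`. Hence `W = U` iff the suitable
functions are complete iff `dataMap` is surjective: every pair `(c, g)` must come from a suitable
function (`wEqU_iff`).

If every `g ∈ L^p(μ)` is integrable on `(-1,1)`, extend it by zero and integrate `ℓ` times, fixing
the constants at the nodes; this works wherever the nodes lie. Integrability follows from a
pointwise Young-type inequality when `p > 1` and `α, β < p - 1`, and from a lower bound on the
weight when `p = 1` and `α, β ≤ 0`. For `ℓ = 1` only a value is prescribed, so local integrability
inside `(-1,1)` suffices, and `f` may be arbitrary outside.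

Otherwise some `g ∈ L^p(μ)` has a primitive tending to infinity at an endpoint. Put all nodes there:
the node of index `ℓ - 1 ≥ 1` demands that `f^{(ℓ-2)}` be differentiable at the endpoint, while
`f^{(ℓ-1)}` is unbounded near it in a way that the mean value theorem forbids. -/

instance fact_one_le_ofReal {p : ℝ} [hp : Fact (1 ≤ p)] : Fact (1 ≤ ENNReal.ofReal p) :=
  ⟨by simpa using hp.out⟩

/-! ### Polynomials with prescribed data and their density in `L^p` -/

theorem exists_polynomial_with_data (ℓ : ℕ) (ω c : Fin ℓ → ℝ) (Q : ℝ[X]) :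
    ∃ P : ℝ[X], derivative^[ℓ] P = Q ∧
      ∀ k : Fin ℓ, (derivative^[k] P).eval (ω k) = c k := by
  induction ℓ generalizing Q with
  | zero => exact ⟨Q, rfl, fun k => k.elim0⟩
  | succ n ih =>
    have hprim : ∃ R : ℝ[X], derivative R = Q := by
      refine ⟨Q.sum fun i a => monomial (i + 1) (a / (i + 1)), ?_⟩
      rw [Polynomial.sum_def, map_sum]
      conv_rhs => rw [Q.as_sum_support]
      refine Finset.sum_congr rfl fun i _ => ?_
      rw [derivative_monomial]
      have : (i : ℝ) + 1 ≠ 0 := by positivity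
      simp [div_mul_cancel₀ _ this]
    obtain ⟨R, hR⟩ := hprim
    -- The constant of integration is chosen so that the derivative of order `n` takes the value `c
    -- n` at the last node; the lower orders are left to the induction.
    obtain ⟨P, hP, hPk⟩ := ih (fun k => ω k.castSucc) (fun k => c k.castSucc)
      (R + C (c (Fin.last n) - R.eval (ω (Fin.last n))))
    refine ⟨P, ?_, fun k => ?_⟩
    · rw [Function.iterate_succ_apply', hP]
      simp [hR]
    · induction k using Fin.lastCases with
      | last => simp [hP]
      | cast k => simpa using hPk k

/-- Bounded continuous functions are dense in `L^p` of a finite measure, and by Weierstrass they are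
uniformly approximable on `[-1,1]`, which carries the measure. -/
theorem exists_polynomial_near_of_memLp {p α β : ℝ} (hp : 1 ≤ p) (hα : -1 < α) (hβ : -1 < β)
    {g : ℝ → ℝ} (hg : MemLp g (ENNReal.ofReal p) (jacobiMeasure α β)) {ε : ENNReal}
    (hε : ε ≠ 0) :
    ∃ Q : ℝ[X], eLpNorm (g - fun x => Q.eval x) (ENNReal.ofReal p) (jacobiMeasure α β) ≤ ε := by
  have := isFiniteMeasure_jacobiMeasure hα hβ
  have hp1 : 1 ≤ ENNReal.ofReal p := by simpa using hp
  obtain ⟨δ, hδ0, hδ⟩ := exists_Lp_half ℝ (jacobiMeasure α β) (ENNReal.ofReal p) hε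
  obtain ⟨φ, hφ, hφp⟩ :=
    hg.exists_boundedContinuous_eLpNorm_sub_le ENNReal.ofReal_ne_top hδ0.ne'
  -- `M = μ(ℝ)^{1/p}` converts a uniform bound `η` into the `L^p` bound `M η`. The `+ 1` below keeps
  -- the denominator positive when `M = 0`.
  set M := jacobiMeasure α β univ ^ (ENNReal.ofReal p).toReal⁻¹ with hM
  have hMtop : M ≠ ⊤ := ENNReal.rpow_ne_top_of_nonneg (by positivity) (measure_ne_top _ _)
  obtain ⟨η, hη0, hη⟩ : ∃ η : ℝ, 0 < η ∧ M * ENNReal.ofReal η ≤ δ := by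
    by_cases hδt : δ = ⊤
    · exact ⟨1, one_pos, by simp [hδt]⟩
    · refine ⟨δ.toReal / (M.toReal + 1), div_pos (ENNReal.toReal_pos hδ0.ne' hδt) (by positivity),
        ?_⟩
      rw [← ENNReal.ofReal_toReal hMtop, ← ENNReal.ofReal_mul ENNReal.toReal_nonneg,
        ENNReal.ofReal_le_iff_le_toReal hδt, ENNReal.ofReal_toReal hMtop, ← mul_div_assoc,
        div_le_iff₀ (by positivity)]
      nlinarith [ENNReal.toReal_nonneg (a := M), ENNReal.toReal_nonneg (a := δ)]
  obtain ⟨Q, hQ⟩ := exists_polynomial_near_of_continuousOn (-1) 1 φ φ.continuous.continuousOn η hη0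
  refine ⟨Q, ?_⟩
  have hsub : (g - fun x => Q.eval x) = (g - φ) + (φ - fun x => Q.eval x) := by
    funext x; simp
  rw [hsub]
  have hmeas : AEStronglyMeasurable (φ - fun x => Q.eval x : ℝ → ℝ) (jacobiMeasure α β) :=
    (φ.continuous.sub Q.continuous).aestronglyMeasurable
  refine (hδ _ _ (hg.1.sub hφp.1) hmeas hφ ?_).le
  refine (eLpNorm_le_of_ae_bound (C := η) ?_).trans hη
  refine (jacobiMeasure_ac α β).ae_le ?_
  filter_upwards [ae_restrict_mem measurableSet_Ioo] with x hx
  rw [Pi.sub_apply, norm_sub_rev]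
  exact (hQ x (Ioo_subset_Icc_self hx)).le

/-! ### Reduction of `W = U` to surjectivity of the data map -/

section Spaces

variable (p α β : ℝ) (ℓ : ℕ) (ω : Fin ℓ → ℝ)

/-- The nodal data `f^{(k)}(ω_k)` and the class of `f^{(ℓ)}` in `L^p(μ^{α,β})`. -/
def dataMap : SuitableFun p α β ℓ ω →ₗ[ℝ]
    (Fin ℓ → ℝ) × Lp ℝ (ENNReal.ofReal p) (jacobiMeasure α β) where
  toFun f := (fun k => iteratedDeriv k f.1 (ω k), f.2.memLp.toLp _)
  map_add' f g := by
    refine Prod.ext (funext fun k => ?_) ?_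
    · exact ((f.2.diffAt_node k).add (g.2.diffAt_node k)).2
    · exact (MemLp.toLp_congr (f.2.add g.2).memLp (f.2.memLp.add g.2.memLp)
        (f.2.ae_iteratedDeriv_add g.2)).trans (MemLp.toLp_add f.2.memLp g.2.memLp)
  map_smul' c f := by
    refine Prod.ext (funext fun k => ?_) ?_
    · exact congrFun (iteratedDeriv_smul' k c f.1) (ω k)
    · exact (MemLp.toLp_congr (f.2.smul c).memLp (f.2.memLp.const_smul c)
        (Eventually.of_forall fun x => congrFun (iteratedDeriv_smul' ℓ c f.1) x)).trans
        (MemLp.toLp_const_smul c f.2.memLp)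

variable [hp : Fact (1 ≤ p)]

/-- The seminorm is the `ℓ^p` norm of `ℓ + 1` numbers (index `none` is the `L^p` norm of `f^{(ℓ)}`),
and the product norm is their maximum. This accounts for the constant `1` here and `(ℓ + 1)^{1/p}`
in the converse estimate. -/
theorem norm_dataMap_le (f : SuitableFun p α β ℓ ω) : ‖dataMap p α β ℓ ω f‖ ≤ ‖f‖ := by
  have hp0 : 0 < p := by linarith [hp.out]
  have key : ∀ i : Option (Fin ℓ), |i.elim
      (lpNorm (iteratedDeriv ℓ f.1) (ENNReal.ofReal p) (jacobiMeasure α β))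
      (fun k => iteratedDeriv k f.1 (ω k))| ≤ ‖f‖ := by
    intro i
    refine le_of_le_of_eq ?_ (f.2.jsNorm_eq hp.out).symm
    rw [one_div, Real.le_rpow_inv_iff_of_pos (abs_nonneg _) (by positivity) hp0]
    exact Finset.single_le_sum (f := fun i : Option (Fin ℓ) => |i.elim
      (lpNorm (iteratedDeriv ℓ f.1) (ENNReal.ofReal p) (jacobiMeasure α β))
      (fun k => iteratedDeriv k f.1 (ω k))| ^ p) (fun i _ => by positivity) (Finset.mem_univ i)
  refine max_le ?_ ?_
  · exact (pi_norm_le_iff_of_nonneg ((abs_nonneg _).trans (key none))).2 fun k => key (some k)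
  · refine le_trans ?_ (key none)
    change ‖f.2.memLp.toLp _‖ ≤ |lpNorm _ _ _|
    rw [Lp.norm_toLp, toReal_eLpNorm f.2.memLp.1]
    exact le_abs_self _

theorem norm_le_dataMap (f : SuitableFun p α β ℓ ω) :
    ‖f‖ ≤ ((ℓ + 1 : ℕ) : ℝ) ^ (1 / p) * ‖dataMap p α β ℓ ω f‖ := by
  have hp0 : 0 < p := by linarith [hp.out]
  have key : ∀ i : Option (Fin ℓ), |i.elim
      (lpNorm (iteratedDeriv ℓ f.1) (ENNReal.ofReal p) (jacobiMeasure α β))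
      (fun k => iteratedDeriv k f.1 (ω k))| ≤ ‖dataMap p α β ℓ ω f‖ := by
    rintro (_ | k)
    · refine le_trans ?_ (norm_snd_le _)
      change |lpNorm _ _ _| ≤ ‖f.2.memLp.toLp _‖
      rw [Lp.norm_toLp, toReal_eLpNorm f.2.memLp.1, abs_of_nonneg lpNorm_nonneg]
    · exact (norm_le_pi_norm (dataMap p α β ℓ ω f).1 k).trans (norm_fst_le _)
  refine (f.2.jsNorm_eq hp.out).trans_le ?_
  have hle := Finset.sum_le_card_nsmul (Finset.univ : Finset (Option (Fin ℓ))) (fun i => |i.elim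
      (lpNorm (iteratedDeriv ℓ f.1) (ENNReal.ofReal p) (jacobiMeasure α β))
      (fun k => iteratedDeriv k f.1 (ω k))| ^ p) (‖dataMap p α β ℓ ω f‖ ^ p)
    fun i _ => Real.rpow_le_rpow (abs_nonneg _) (key i) hp0.le
  refine (Real.rpow_le_rpow (by positivity) hle (by positivity)).trans_eq ?_
  rw [Finset.card_univ, Fintype.card_option, Fintype.card_fin, nsmul_eq_mul,
    Real.mul_rpow (by positivity) (by positivity), one_div,
    Real.rpow_rpow_inv (norm_nonneg _) hp0.ne']

theorem isUniformInducing_dataMap : IsUniformInducing (dataMap p α β ℓ ω) := by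
  refine (AddMonoidHomClass.antilipschitz_of_bound (dataMap p α β ℓ ω)
    (K := ⟨((ℓ + 1 : ℕ) : ℝ) ^ (1 / p), by positivity⟩)
    (norm_le_dataMap p α β ℓ ω)).isUniformInducing ?_
  exact (AddMonoidHomClass.lipschitz_of_bound (dataMap p α β ℓ ω) 1
    fun f => by simpa using norm_dataMap_le p α β ℓ ω f).uniformContinuous

variable [hα : Fact (-1 < α)] [hβ : Fact (-1 < β)]

/-- The nodal values are matched exactly, so the only error is that of approximating `g` by `Q` in
`L^p`. -/
theorem denseRange_dataMap_polyToFun :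
    DenseRange fun P => dataMap p α β ℓ ω (polyToFun p α β ℓ ω P) := by
  rintro ⟨c, g⟩
  rw [Metric.mem_closure_range_iff]
  intro ε hε
  obtain ⟨Q, hQ⟩ := exists_polynomial_near_of_memLp hp.out hα.out hβ.out (Lp.memLp g)
    (ε := ENNReal.ofReal (ε / 2)) (by simpa using hε)
  obtain ⟨P, hP, hPc⟩ := exists_polynomial_with_data ℓ ω c Q
  refine ⟨P, ?_⟩
  have h1 : (dataMap p α β ℓ ω (polyToFun p α β ℓ ω P)).1 = c := by
    funext k
    change iteratedDeriv k (fun x => P.eval x) (ω k) = c k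
    rw [iteratedDeriv_eval]
    exact hPc k
  have hder : iteratedDeriv ℓ (fun x => P.eval x) = fun x => Q.eval x := by
    rw [iteratedDeriv_eval, hP]
  have h2 : dist g (dataMap p α β ℓ ω (polyToFun p α β ℓ ω P)).2 ≤ ε / 2 := by
    change dist g ((polyToFun p α β ℓ ω P).2.memLp.toLp _) ≤ ε / 2
    rw [Lp.dist_def]
    refine ENNReal.toReal_le_of_le_ofReal (by positivity) (le_trans (le_of_eq ?_) hQ)
    refine eLpNorm_congr_ae ?_
    filter_upwards [(polyToFun p α β ℓ ω P).2.memLp.coeFn_toLp] with x hx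
    rw [Pi.sub_apply, Pi.sub_apply, hx]
    exact congrArg _ (congrFun hder x)
  rw [Prod.dist_eq, h1, dist_self]
  exact max_lt hε (by linarith)

theorem denseRange_polyToFun : DenseRange (polyToFun p α β ℓ ω) := by
  rw [DenseRange, (isUniformInducing_dataMap p α β ℓ ω).isInducing.dense_iff]
  intro f
  rw [← range_comp]
  exact denseRange_dataMap_polyToFun p α β ℓ ω _

/-- The target is complete and the range is dense, so a complete, hence closed, range is everything.
-/
theorem dataMap_surjective_iff_completeSpace :
    Function.Surjective (dataMap p α β ℓ ω) ↔ CompleteSpace (SuitableFun p α β ℓ ω) := by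
  constructor
  · intro h
    exact ((isUniformInducing_dataMap p α β ℓ ω).completeSpace_congr h).2 inferInstance
  · intro h
    have hcl :=
      ((completeSpace_iff_isComplete_range (isUniformInducing_dataMap p α β ℓ ω)).1 h).isClosed
    have hd : Dense (range (dataMap p α β ℓ ω)) :=
      (denseRange_dataMap_polyToFun p α β ℓ ω).mono (range_comp_subset_range _ _)
    rw [← range_eq_univ, ← hcl.closure_eq, hd.closure_eq]

/-- The inclusion of the polynomials into `U`. -/
def polyToU : PolySpace p α β ℓ ω →ₗ[ℝ] U p α β ℓ ω where
  toFun P := SeparationQuotient.mk (polyToFun p α β ℓ ω P)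
  map_add' P Q := by
    rw [← SeparationQuotient.mk_add]
    exact congrArg _ (Subtype.ext (funext fun x =>
      Polynomial.eval_add (x := x) (p := (show ℝ[X] from P)) (q := (show ℝ[X] from Q))))
  map_smul' c P := by
    rw [RingHom.id_apply, ← SeparationQuotient.mk_smul]
    exact congrArg _ (Subtype.ext (funext fun x =>
      Polynomial.eval_smul (x := x) c (show ℝ[X] from P)))

/-- A completion is complete, and completeness passes along an isometry. Conversely, if `U` is
complete then `U` and `W` are both complete and contain the polynomials densely with the same norm,
so the identity on polynomials extends. -/
theorem wEqU_iff_completeSpace :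
    WEqU p α β ℓ ω ↔ CompleteSpace (SuitableFun p α β ℓ ω) := by
  constructor
  · rintro ⟨e, -⟩
    rw [← SeparationQuotient.completeSpace_iff]
    exact (e.isometry.isUniformInducing.completeSpace_congr e.surjective).2 inferInstance
  · intro h
    have hd1 : DenseRange (polyToU p α β ℓ ω) :=
      SeparationQuotient.surjective_mk.denseRange.comp (denseRange_polyToFun p α β ℓ ω)
        SeparationQuotient.continuous_mk
    refine ⟨(LinearEquiv.refl ℝ (PolySpace p α β ℓ ω)).extendOfIsometry (polyToU p α β ℓ ω)
      (UniformSpace.Completion.toComplₗᵢ (𝕜 := ℝ)).toLinearMap hd1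
      UniformSpace.Completion.denseRange_coe fun P => ?_, fun P => ?_⟩
    · exact UniformSpace.Completion.norm_coe P
    · exact LinearEquiv.extendOfIsometry_eq _ (polyToU p α β ℓ ω) _ _ _ _ P

/-- `W = U` holds exactly when all nodal data and all functions in `L^p` are attained. -/
theorem wEqU_iff : WEqU p α β ℓ ω ↔
    ∀ (c : Fin ℓ → ℝ) (g : ℝ → ℝ), MemLp g (ENNReal.ofReal p) (jacobiMeasure α β) →
      ∃ f, IsSuitable p α β ℓ ω f ∧ (∀ k : Fin ℓ, iteratedDeriv k f (ω k) = c k) ∧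
        iteratedDeriv ℓ f =ᵐ[jacobiMeasure α β] g := by
  rw [wEqU_iff_completeSpace, ← dataMap_surjective_iff_completeSpace]
  constructor
  · intro h c g hg
    obtain ⟨f, hf⟩ := h (c, hg.toLp g)
    refine ⟨f.1, f.2, fun k => congrFun (congrArg Prod.fst hf) k, ?_⟩
    exact (MemLp.toLp_eq_toLp_iff f.2.memLp hg).1 (congrArg Prod.snd hf)
  · rintro h ⟨c, g⟩
    obtain ⟨f, hf, hfc, hfg⟩ := h c g (Lp.memLp g)
    refine ⟨⟨f, hf⟩, Prod.ext (funext hfc) ?_⟩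
    exact ((MemLp.toLp_eq_toLp_iff hf.memLp (Lp.memLp g)).2 hfg).trans (Lp.toLp_coeFn g _)

end Spaces

/-! ### Functions with prescribed nodal data -/

theorem diffAtOrder_of_contDiff {k : ℕ} {f : ℝ → ℝ} (hf : ContDiff ℝ k f) (x : ℝ) :
    DiffAtOrder k f x := by
  induction k generalizing x with
  | zero => trivial
  | succ k ih =>
    exact ⟨Eventually.of_forall (ih (hf.of_le (by exact_mod_cast k.le_succ))),
      hf.differentiable_iteratedDeriv k (by exact_mod_cast k.lt_succ_self) x⟩

/-- Integrate from the highest order downwards, starting each primitive at its own node with the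
prescribed value. -/
theorem exists_contDiff_with_data (n : ℕ) (ω c : Fin n → ℝ) {φ : ℝ → ℝ} (hφ : Continuous φ) :
    ∃ F : ℝ → ℝ, ContDiff ℝ n F ∧ iteratedDeriv n F = φ ∧
      ∀ k : Fin n, iteratedDeriv k F (ω k) = c k := by
  induction n generalizing φ with
  | zero =>
    exact ⟨φ, contDiff_zero.2 hφ, iteratedDeriv_zero, fun k => k.elim0⟩
  | succ n ih =>
    set ψ : ℝ → ℝ := fun x => c (Fin.last n) + ∫ t in ω (Fin.last n)..x, φ t with hψ
    have hder : ∀ x, HasDerivAt ψ (φ x) x := fun x =>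
      (hφ.integral_hasStrictDerivAt _ x).hasDerivAt.const_add _
    have hψd : Differentiable ℝ ψ := fun x => (hder x).differentiableAt
    obtain ⟨F, hF, hFn, hFk⟩ := ih (fun k => ω k.castSucc) (fun k => c k.castSucc) hψd.continuous
    have hFs : iteratedDeriv (n + 1) F = φ := by
      rw [iteratedDeriv_succ, hFn]
      exact funext fun x => (hder x).deriv
    refine ⟨F, ?_, hFs, fun k => ?_⟩
    · rw [contDiff_nat_iff_iteratedDeriv] at hF ⊢
      refine ⟨fun m hm => ?_, fun m hm => ?_⟩
      · rcases Nat.lt_or_eq_of_le hm with h | rfl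
        · exact hF.1 m (Nat.le_of_lt_succ h)
        · rwa [hFs]
      · rcases Nat.lt_or_eq_of_le (Nat.le_of_lt_succ hm) with h | rfl
        · exact hF.2 m h
        · rwa [hFn]
    · induction k using Fin.lastCases with
      | last => simp [hFn, hψ]
      | cast k => simpa using hFk k

/-- Moving the base point from `x₀`, which may lie outside the interval, to `a` changes the
primitive by a constant. -/
theorem absolutelyContinuousOnInterval_const_add_integral {g : ℝ → ℝ} {a b x₀ : ℝ} (c : ℝ)
    (h₀ : IntervalIntegrable g volume x₀ a) (h : IntervalIntegrable g volume a b) :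
    AbsolutelyContinuousOnInterval (fun x => c + ∫ t in x₀..x, g t) a b := by
  have h1 : AbsolutelyContinuousOnInterval (fun _ : ℝ => c + ∫ t in x₀..a, g t) a b :=
    (contDiff_const (n := 1)).contDiffOn.absolutelyContinuousOnInterval
  refine (h1.add (h.absolutelyContinuousOnInterval_intervalIntegral left_mem_uIcc)).congr' ?_
  refine Filter.eventuallyEq_of_mem (mem_inf_of_right (mem_principal_self _)) ?_
  rintro ⟨n, I⟩ hI
  refine Finset.sum_congr rfl fun i hi => ?_
  have hsub : ∀ y ∈ uIcc a b, ((fun _ : ℝ => c + ∫ t in x₀..a, g t) + fun x => ∫ t in a..x, g t) y =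
      c + ∫ t in x₀..y, g t := by
    intro y hy
    rw [Pi.add_apply, add_assoc, intervalIntegral.integral_add_adjacent_intervals h₀
      (h.mono_set (uIcc_subset_uIcc_left hy))]
  have := hI.1 i hi
  simp only [hsub _ this.1, hsub _ this.2]

theorem exists_isSuitable_of_integrableOn {p α β : ℝ} {n : ℕ} (ω c : Fin (n + 1) → ℝ)
    {g : ℝ → ℝ} (hg : MemLp g (ENNReal.ofReal p) (jacobiMeasure α β))
    (hgi : IntegrableOn g (Ioo (-1) 1)) :
    ∃ f, IsSuitable p α β (n + 1) ω f ∧ (∀ k : Fin (n + 1), iteratedDeriv k f (ω k) = c k) ∧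
      iteratedDeriv (n + 1) f =ᵐ[jacobiMeasure α β] g := by
  -- Extension by zero makes the primitive continuous on all of `ℝ`, so nodes at or beyond the
  -- endpoints need no separate treatment.
  set G : ℝ → ℝ := (Ioo (-1 : ℝ) 1).indicator g with hG
  have hGi : Integrable G := (integrable_indicator_iff measurableSet_Ioo).2 hgi
  set ψ : ℝ → ℝ := fun x => c (Fin.last n) + ∫ t in ω (Fin.last n)..x, G t with hψ
  have hψc : Continuous ψ :=
    continuous_const.add (intervalIntegral.continuous_primitive
      (fun a b => hGi.intervalIntegrable) _)
  obtain ⟨F, hF, hFn, hFk⟩ :=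
    exists_contDiff_with_data n (fun k => ω k.castSucc) (fun k => c k.castSucc) hψc
  have hae : iteratedDeriv (n + 1) F =ᵐ[jacobiMeasure α β] g := by
    refine (jacobiMeasure_ac α β).ae_eq ?_
    filter_upwards [ae_restrict_of_ae
      (LocallyIntegrable.ae_hasDerivAt_integral hGi.locallyIntegrable),
      ae_restrict_mem measurableSet_Ioo] with x hx hx1
    rw [iteratedDeriv_succ, hFn, ((hx (ω (Fin.last n))).const_add _).deriv, hG,
      indicator_of_mem hx1]
  refine ⟨F, ⟨fun k => ?_, fun x _ => ?_, fun a b _ _ _ => ?_, hg.ae_eq hae.symm⟩, fun k => ?_, hae⟩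
  · exact diffAtOrder_of_contDiff
      (hF.of_le (by exact_mod_cast Nat.le_of_lt_succ k.isLt)) _
  · exact diffAtOrder_of_contDiff hF x
  · rw [Nat.add_sub_cancel, hFn]
    exact absolutelyContinuousOnInterval_const_add_integral _ hGi.intervalIntegrable
      hGi.intervalIntegrable
  · induction k using Fin.lastCases with
    | last => simp [hFn, hψ]
    | cast k => simpa using hFk k

/-! ### Integrability with respect to Lebesgue measure -/

/-- On `s` Lebesgue measure is at most `m⁻¹ μ`, and it is finite there, so `L^p(μ)` restricts into
`L^p(s) ⊆ L^1(s)`. -/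
theorem integrableOn_of_memLp_of_le {p α β : ℝ} (hp : 1 ≤ p) {s : Set ℝ} (hs : MeasurableSet s)
    (hsub : s ⊆ Ioo (-1) 1) {m : ℝ} (hm : 0 < m)
    (hle : ∀ x ∈ s, m ≤ (1 - x) ^ α * (1 + x) ^ β) {g : ℝ → ℝ}
    (hg : MemLp g (ENNReal.ofReal p) (jacobiMeasure α β)) : IntegrableOn g s := by
  have hmeas : volume.restrict s ≤ ENNReal.ofReal m⁻¹ • jacobiMeasure α β := by
    refine Measure.le_iff.2 fun t ht => ?_
    rw [Measure.restrict_apply ht, Measure.smul_apply, smul_eq_mul, jacobiMeasure,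
      withDensity_apply _ ht, Measure.restrict_restrict ht]
    calc volume (t ∩ s) = ENNReal.ofReal m⁻¹ * ∫⁻ _ in t ∩ s, ENNReal.ofReal m := by
          rw [setLIntegral_const, ← mul_assoc, ← ENNReal.ofReal_mul (by positivity),
            inv_mul_cancel₀ hm.ne', ENNReal.ofReal_one, one_mul]
      _ ≤ ENNReal.ofReal m⁻¹ *
          ∫⁻ x in t ∩ s, ENNReal.ofReal ((1 - x) ^ α * (1 + x) ^ β) := by
          exact mul_le_mul' le_rfl (setLIntegral_mono' (ht.inter hs) fun x hx =>
            ENNReal.ofReal_le_ofReal (hle x hx.2))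
      _ ≤ _ := by
          exact mul_le_mul' le_rfl (lintegral_mono_set (inter_subset_inter_right t hsub))
  have hfin : IsFiniteMeasure (volume.restrict s) :=
    ⟨by rw [Measure.restrict_apply_univ]
        exact (measure_mono hsub).trans_lt measure_Ioo_lt_top⟩
  exact (hg.of_measure_le_smul ENNReal.ofReal_ne_top hmeas).integrable (by simpa using hp)

theorem integrableOn_Icc_of_memLp {p α β : ℝ} (hp : 1 ≤ p) {a b : ℝ} (ha : -1 < a) (hb : b < 1)
    {g : ℝ → ℝ} (hg : MemLp g (ENNReal.ofReal p) (jacobiMeasure α β)) :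
    IntegrableOn g (Icc a b) := by
  rcases lt_or_ge b a with hab | hab
  · simp [Icc_eq_empty hab.not_ge]
  have hpos : ∀ x ∈ Icc a b, 0 < 1 - x ∧ 0 < 1 + x := fun x hx =>
    ⟨by linarith [hx.2], by linarith [hx.1]⟩
  have hcont : ContinuousOn (fun x : ℝ => (1 - x) ^ α * (1 + x) ^ β) (Icc a b) :=
    (ContinuousOn.rpow_const (by fun_prop) fun x hx => Or.inl (hpos x hx).1.ne').mul
      (ContinuousOn.rpow_const (by fun_prop) fun x hx => Or.inl (hpos x hx).2.ne')
  obtain ⟨x₀, hx₀, hmin⟩ := isCompact_Icc.exists_isMinOn (nonempty_Icc.2 hab) hcont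
  exact integrableOn_of_memLp_of_le hp measurableSet_Icc
    (fun x hx => ⟨ha.trans_le hx.1, hx.2.trans_lt hb⟩)
    (mul_pos (Real.rpow_pos_of_pos (hpos x₀ hx₀).1 _) (Real.rpow_pos_of_pos (hpos x₀ hx₀).2 _))
    (fun x hx => hmin hx) hg

theorem integrableOn_Ioo_of_nonpos {p α β : ℝ} (hp : 1 ≤ p) (hα : α ≤ 0) (hβ : β ≤ 0)
    {g : ℝ → ℝ} (hg : MemLp g (ENNReal.ofReal p) (jacobiMeasure α β)) :
    IntegrableOn g (Ioo (-1) 1) := by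
  refine integrableOn_of_memLp_of_le hp measurableSet_Ioo subset_rfl
    (m := 2 ^ α * 2 ^ β) (by positivity) (fun x hx => ?_) hg
  exact mul_le_mul
    (Real.rpow_le_rpow_of_nonpos (by linarith [hx.2]) (by linarith [hx.1]) hα)
    (Real.rpow_le_rpow_of_nonpos (by linarith [hx.1]) (by linarith [hx.2]) hβ)
    (by positivity) (Real.rpow_nonneg (by linarith [hx.2]) _)

theorem memLp_jacobiMeasure_iff {p α β : ℝ} (hp : 1 ≤ p) {g : ℝ → ℝ}
    (hgm : AEStronglyMeasurable g (volume.restrict (Ioo (-1) 1))) :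
    MemLp g (ENNReal.ofReal p) (jacobiMeasure α β) ↔
      IntegrableOn (fun x => (1 - x) ^ α * (1 + x) ^ β * |g x| ^ p) (Ioo (-1) 1) := by
  have hp0 : 0 < p := by linarith
  rw [← integrable_norm_rpow_iff (hgm.mono_ac (jacobiMeasure_ac α β)) (by simpa using hp0)
    ENNReal.ofReal_ne_top, ENNReal.toReal_ofReal hp0.le, jacobiMeasure, IntegrableOn,
    integrable_withDensity_iff_integrable_smul' (by fun_prop)
      (Eventually.of_forall fun _ => ENNReal.ofReal_lt_top)]
  refine integrable_congr ?_
  filter_upwards [ae_restrict_mem measurableSet_Ioo] with x hx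
  rw [ENNReal.toReal_ofReal (mul_nonneg (Real.rpow_nonneg (by linarith [hx.2]) _)
    (Real.rpow_nonneg (by linarith [hx.1]) _))]
  rfl

theorem integrableOn_jacobiWeight {α β : ℝ} (hα : -1 < α) (hβ : -1 < β) :
    IntegrableOn (fun x : ℝ => (1 - x) ^ α * (1 + x) ^ β) (Ioo (-1) 1) := by
  have := isFiniteMeasure_jacobiMeasure hα hβ
  have h : MemLp (fun _ : ℝ => (1 : ℝ)) (ENNReal.ofReal 1) (jacobiMeasure α β) := memLp_const 1
  simpa using (memLp_jacobiMeasure_iff le_rfl aestronglyMeasurable_const).1 h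

theorem restrict_ac_jacobiMeasure (α β : ℝ) :
    volume.restrict (Ioo (-1 : ℝ) 1) ≪ jacobiMeasure α β := by
  refine withDensity_absolutelyContinuous' (by fun_prop) ?_
  filter_upwards [ae_restrict_mem measurableSet_Ioo] with x hx
  simpa using mul_pos (Real.rpow_pos_of_pos (by linarith [hx.2] : 0 < 1 - x) α)
    (Real.rpow_pos_of_pos (by linarith [hx.1] : 0 < 1 + x) β)

/-- With `w` the weight, `|g| ≤ w |g|^p + w^{-1/(p-1)}` pointwise. The last term is again a Jacobi
weight, with exponents `-α/(p-1)` and `-β/(p-1)`, which exceed `-1` exactly when `α, β < p - 1`. -/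
theorem integrableOn_Ioo_of_lt {p α β : ℝ} (hp : 1 < p) (hα : α < p - 1) (hβ : β < p - 1)
    {g : ℝ → ℝ} (hg : MemLp g (ENNReal.ofReal p) (jacobiMeasure α β)) :
    IntegrableOn g (Ioo (-1) 1) := by
  have hp1 : 0 < p - 1 := by linarith
  have hgm := hg.1.mono_ac (restrict_ac_jacobiMeasure α β)
  have h1 := (memLp_jacobiMeasure_iff hp.le hgm).1 hg
  have h2 : IntegrableOn (fun x : ℝ => (1 - x) ^ (-α / (p - 1)) * (1 + x) ^ (-β / (p - 1)))
      (Ioo (-1) 1) := by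
    refine integrableOn_jacobiWeight ?_ ?_ <;> rw [lt_div_iff₀ hp1] <;> linarith
  refine (h1.add h2).mono' hgm ?_
  filter_upwards [ae_restrict_mem measurableSet_Ioo] with x hx
  have hx1 : 0 < 1 - x := by linarith [hx.2]
  have hx2 : 0 < 1 + x := by linarith [hx.1]
  have hw : 0 < (1 - x) ^ α * (1 + x) ^ β :=
    mul_pos (Real.rpow_pos_of_pos hx1 _) (Real.rpow_pos_of_pos hx2 _)
  have hv : (1 - x) ^ (-α / (p - 1)) * (1 + x) ^ (-β / (p - 1)) =
      ((1 - x) ^ α * (1 + x) ^ β) ^ (-1 / (p - 1)) := by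
    rw [Real.mul_rpow (by positivity) (by positivity), ← Real.rpow_mul hx1.le,
      ← Real.rpow_mul hx2.le]
    congr 2 <;> ring
  rw [Pi.add_apply, hv, Real.norm_eq_abs]
  set w := (1 - x) ^ α * (1 + x) ^ β
  -- Either `|g|` is at least `w^{-1/(p-1)}`, so that `w |g|^{p-1} ≥ 1` and the first term
  -- dominates, or the second term dominates.
  rcases le_or_gt (w ^ (-1 / (p - 1))) |g x| with hle | hlt
  · have h3 : 1 ≤ w * |g x| ^ (p - 1) := by
      calc (1 : ℝ) = w * (w ^ (-1 / (p - 1))) ^ (p - 1) := by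
            rw [← Real.rpow_mul hw.le, div_mul_cancel₀ _ hp1.ne', Real.rpow_neg_one,
              mul_inv_cancel₀ hw.ne']
        _ ≤ _ := by gcongr
    have h4 : |g x| ^ p = |g x| ^ (p - 1) * |g x| := by
      have h0 : |g x| ≠ 0 := ((Real.rpow_pos_of_pos hw _).trans_le hle).ne'
      rw [Real.rpow_sub_one h0, div_mul_cancel₀ _ h0]
    rw [h4, ← mul_assoc]
    have := mul_le_mul_of_nonneg_right h3 (abs_nonneg (g x))
    have := Real.rpow_nonneg hw.le (-1 / (p - 1))
    linarith
  · have : 0 ≤ w * |g x| ^ p := by positivity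
    linarith

/-! ### The case `ℓ = 1`: local integrability suffices -/

theorem exists_isSuitable_one {p α β : ℝ} (hp : 1 ≤ p) (ω c : Fin 1 → ℝ)
    {g : ℝ → ℝ} (hg : MemLp g (ENNReal.ofReal p) (jacobiMeasure α β)) :
    ∃ f, IsSuitable p α β 1 ω f ∧ (∀ k : Fin 1, iteratedDeriv k f (ω k) = c k) ∧
      iteratedDeriv 1 f =ᵐ[jacobiMeasure α β] g := by
  classical
  obtain ⟨x₀, hx₀, hωx⟩ : ∃ x₀ ∈ Ioo (-1 : ℝ) 1, ω 0 ∈ Ioo (-1 : ℝ) 1 → ω 0 = x₀ := by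
    by_cases h : ω 0 ∈ Ioo (-1 : ℝ) 1
    · exact ⟨ω 0, h, fun _ => rfl⟩
    · exact ⟨0, by norm_num, fun h' => absurd h' h⟩
  have hint : ∀ a ∈ Ioo (-1 : ℝ) 1, ∀ b ∈ Ioo (-1 : ℝ) 1, IntervalIntegrable g volume a b :=
    fun a ha b hb => (integrableOn_Icc_of_memLp hp (lt_min ha.1 hb.1) (max_lt ha.2 hb.2)
      hg).intervalIntegrable
  set ψ : ℝ → ℝ := fun x => c 0 + ∫ t in x₀..x, g t with hψ
  -- The primitive may blow up at the endpoints. Only the value at the node matters, so a node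
  -- outside `(-1,1)` receives it from the constant branch.
  set f : ℝ → ℝ := fun x => if x ∈ Ioo (-1 : ℝ) 1 then ψ x else c 0 with hf
  have heq : ∀ x ∈ Ioo (-1 : ℝ) 1, f =ᶠ[𝓝 x] ψ := fun x hx =>
    (isOpen_Ioo.eventually_mem hx).mono fun y hy => if_pos hy
  have hae : iteratedDeriv 1 f =ᵐ[jacobiMeasure α β] g := by
    refine (jacobiMeasure_ac α β).ae_eq ((ae_restrict_iff' measurableSet_Ioo).2 ?_)
    -- Differentiation of the integral holds almost everywhere on each compact subinterval; rational
    -- endpoints leave only countably many exceptional null sets.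
    have h : ∀ q r : ℚ, ∀ᵐ x : ℝ, (q : ℝ) ∈ Ioo (-1 : ℝ) 1 → (r : ℝ) ∈ Ioo (-1 : ℝ) 1 →
        x ∈ uIcc (q : ℝ) r → ∀ y ∈ uIcc (q : ℝ) r,
          HasDerivAt (fun x => ∫ t in y..x, g t) (g x) x := by
      intro q r
      by_cases hqr : (q : ℝ) ∈ Ioo (-1 : ℝ) 1 ∧ (r : ℝ) ∈ Ioo (-1 : ℝ) 1
      · filter_upwards [(hint q hqr.1 r hqr.2).ae_hasDerivAt_integral] with x hx _ _
        exact hx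
      · exact Eventually.of_forall fun x h1 h2 => absurd ⟨h1, h2⟩ hqr
    filter_upwards [ae_all_iff.2 fun q => ae_all_iff.2 (h q)] with x hx hx1
    obtain ⟨q, hq1, hq2⟩ := exists_rat_btwn (lt_min hx1.1 hx₀.1)
    obtain ⟨r, hr1, hr2⟩ := exists_rat_btwn (max_lt hx1.2 hx₀.2)
    have hq := lt_min_iff.1 hq2
    have hr := max_lt_iff.1 hr1
    have hder := hx q r ⟨hq1, by linarith [hx1.2]⟩ ⟨by linarith [hx1.1], hr2⟩
      (Icc_subset_uIcc ⟨hq.1.le, hr.1.le⟩) x₀ (Icc_subset_uIcc ⟨hq.2.le, hr.2.le⟩)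
    rw [iteratedDeriv_one, (heq x hx1).deriv_eq, (hder.const_add (c 0)).deriv]
  refine ⟨f, ⟨fun k => ?_, fun x _ => trivial, fun a b ha hab hb => ?_, hg.ae_eq hae.symm⟩,
    fun k => ?_, hae⟩
  · rw [Fin.fin_one_eq_zero k]
    trivial
  · have haI : a ∈ Ioo (-1 : ℝ) 1 := ⟨ha, hab.trans_lt hb⟩
    have hbI : b ∈ Ioo (-1 : ℝ) 1 := ⟨ha.trans_le hab, hb⟩
    refine (absolutelyContinuousOnInterval_const_add_integral (c 0) (hint x₀ hx₀ a haI)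
      (hint a haI b hbI)).congr' ?_
    refine Filter.eventuallyEq_of_mem (mem_inf_of_right (mem_principal_self _)) ?_
    rintro ⟨n, I⟩ hI
    refine Finset.sum_congr rfl fun i hi => ?_
    have hsub : ∀ y ∈ uIcc a b, iteratedDeriv (1 - 1) f y = ψ y := by
      intro y hy
      rw [uIcc_of_le hab] at hy
      exact if_pos ⟨ha.trans_le hy.1, hy.2.trans_lt hb⟩
    have := hI.1 i hi
    simp only [hsub _ this.1, hsub _ this.2, hψ]
  · rw [Fin.fin_one_eq_zero k]
    by_cases h : ω 0 ∈ Ioo (-1 : ℝ) 1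
    · simp [hf, hψ, hωx h]
    · simp only [Fin.val_zero, iteratedDeriv_zero, hf]
      exact if_neg h

/-! ### A function of `L^p` that is not integrable at the endpoint -/

/-- A function supported in `(0,1)` that is not integrable at `1`. -/
def logSingular : ℝ → ℝ :=
  (Ioo (0 : ℝ) 1).indicator fun x => (1 - x)⁻¹ * (1 - Real.log (1 - x))⁻¹

theorem measurable_logSingular : Measurable logSingular :=
  Measurable.indicator (by fun_prop) measurableSet_Ioo

theorem one_le_one_sub_log {x : ℝ} (h0 : 0 ≤ x) (h1 : x < 1) : 1 ≤ 1 - Real.log (1 - x) := by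
  linarith [Real.log_nonpos (by linarith : 0 ≤ 1 - x) (by linarith)]

theorem hasDerivAt_one_sub_log {x : ℝ} (h1 : x < 1) :
    HasDerivAt (fun x : ℝ => 1 - Real.log (1 - x)) (1 - x)⁻¹ x := by
  have := (((hasDerivAt_id x).const_sub 1).log (by simp; linarith)).const_sub 1
  simpa [neg_div] using this

theorem tendsto_one_sub_log : Tendsto (fun x : ℝ => 1 - Real.log (1 - x)) (𝓝[<] 1) atTop := by
  have h : Tendsto (fun x : ℝ => 1 - x) (𝓝[<] 1) (𝓝[>] 0) := by
    refine tendsto_nhdsWithin_iff.2 ⟨?_, ?_⟩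
    · have : Tendsto (fun x : ℝ => 1 - x) (𝓝 1) (𝓝 (1 - 1)) := (by fun_prop : Continuous _).tendsto 1
      simpa using this.mono_left nhdsWithin_le_nhds
    · filter_upwards [self_mem_nhdsWithin] with x hx
      simpa using hx
  have h2 := tendsto_neg_atBot_atTop.comp (Real.tendsto_log_nhdsGT_zero.comp h)
  exact tendsto_atTop_add_const_left _ 1 h2

/-- On `(0,1)` a primitive is `log (1 - log (1 - x))`, which diverges at `1`. -/
theorem tendsto_integral_logSingular :
    Tendsto (fun x => ∫ t in (0 : ℝ)..x, logSingular t) (𝓝[<] 1) atTop := by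
  refine (Real.tendsto_log_atTop.comp tendsto_one_sub_log).congr' ?_
  filter_upwards [Ioo_mem_nhdsLT (show (0 : ℝ) < 1 by norm_num)] with x hx
  have heq : ∫ t in (0 : ℝ)..x, logSingular t =
      ∫ t in (0 : ℝ)..x, (1 - t)⁻¹ * (1 - Real.log (1 - t))⁻¹ := by
    refine intervalIntegral.integral_congr_ae (Eventually.of_forall fun t ht => ?_)
    rw [uIoc_of_le hx.1.le] at ht
    exact indicator_of_mem (show t ∈ Ioo (0 : ℝ) 1 from ⟨ht.1, ht.2.trans_lt hx.2⟩) _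
  have hmem : ∀ t ∈ uIcc 0 x, 0 ≤ t ∧ t < 1 := by
    intro t ht
    rw [uIcc_of_le hx.1.le] at ht
    exact ⟨ht.1, ht.2.trans_lt hx.2⟩
  rw [heq, intervalIntegral.integral_eq_sub_of_hasDerivAt
    (f := fun t => Real.log (1 - Real.log (1 - t)))]
  · simp
  · intro t ht
    have := (hasDerivAt_one_sub_log (hmem t ht).2).log
      (by linarith [one_le_one_sub_log (hmem t ht).1 (hmem t ht).2])
    simpa [div_eq_mul_inv] using this
  · refine ContinuousOn.intervalIntegrable fun t ht => ContinuousAt.continuousWithinAt ?_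
    have h1 : 1 - t ≠ 0 := by linarith [(hmem t ht).2]
    refine ContinuousAt.mul (ContinuousAt.inv₀ (by fun_prop) h1) (ContinuousAt.inv₀
      (hasDerivAt_one_sub_log (hmem t ht).2).continuousAt
      (by linarith [one_le_one_sub_log (hmem t ht).1 (hmem t ht).2]))

theorem integrableOn_log_rpow {p : ℝ} (hp : 1 < p) :
    IntegrableOn (fun x : ℝ => (1 - x)⁻¹ * (1 - Real.log (1 - x)) ^ (-p)) (Ioo 0 1) := by
  set A : ℝ → ℝ := fun x => (1 - Real.log (1 - x)) ^ (1 - p) / (1 - p) with hA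
  have hder : ∀ x, 0 ≤ x → x < 1 →
      HasDerivAt A ((1 - x)⁻¹ * (1 - Real.log (1 - x)) ^ (-p)) x := by
    intro x h0 h1
    have := ((hasDerivAt_one_sub_log h1).rpow_const (p := 1 - p)
      (Or.inl (by linarith [one_le_one_sub_log h0 h1]))).div_const (1 - p)
    convert! this using 1
    have : 1 - p ≠ 0 := by linarith
    rw [show 1 - p - 1 = -p by ring]
    field_simp
  have hlim : Tendsto A (𝓝[<] 1) (𝓝 0) := by
    have := ((tendsto_rpow_neg_atTop (y := p - 1) (by linarith)).comp
      tendsto_one_sub_log).div_const (1 - p)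
    simpa [hA, Function.comp_def] using this
  have hcont : ContinuousOn (Function.update A 1 0) (Icc 0 1) := by
    have hIco : Icc (0 : ℝ) 1 \ {1} = Ico 0 1 := by
      ext x
      simp [lt_iff_le_and_ne]
    rw [continuousOn_update_iff, hIco]
    refine ⟨fun x hx => (hder x hx.1 hx.2).continuousAt.continuousWithinAt, fun _ => ?_⟩
    exact hlim.mono_left (nhdsWithin_mono _ fun x hx => hx.2)
  have := intervalIntegral.integrableOn_deriv_of_nonneg hcont
    (g' := fun x : ℝ => (1 - x)⁻¹ * (1 - Real.log (1 - x)) ^ (-p))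
    (fun x hx => (hder x hx.1.le hx.2).congr_of_eventuallyEq
      ((eventually_ne_nhds hx.2.ne).mono fun y hy => Function.update_of_ne hy _ _))
    (fun x hx => mul_nonneg (inv_nonneg.2 (by linarith [hx.2]))
      (Real.rpow_nonneg (by linarith [one_le_one_sub_log hx.1.le hx.2]) _))
  exact this.mono_set Ioo_subset_Ioc_self

theorem integrableOn_one_sub_rpow {α : ℝ} (hα : -1 < α) :
    IntegrableOn (fun x : ℝ => (1 - x) ^ α) (Ioo 0 1) := by
  have h : IntervalIntegrable (fun x : ℝ => (1 - x) ^ α) volume 0 1 := by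
    simpa using (intervalIntegral.intervalIntegrable_rpow' (a := 1) (b := 0) hα).comp_sub_left 1
  rwa [intervalIntegrable_iff_integrableOn_Ioo_of_le (by norm_num)] at h

/-- For `p > 1` the logarithm makes even the borderline `α = p - 1` work: the integrand is at most a
constant times `(1-x)⁻¹ (1 - log (1-x))^{-p}`. For `p = 1` and `α > 0` the bound `(1-x)^{α-1}` is
enough. The exponent `β` contributes only the constant `2^|β|`, because the support lies in `(0,1)`.
-/
theorem memLp_logSingular {p α : ℝ} (β : ℝ) (h : 1 < p ∧ p - 1 ≤ α ∨ p = 1 ∧ 0 < α) :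
    MemLp logSingular (ENNReal.ofReal p) (jacobiMeasure α β) := by
  have hp : 1 ≤ p := by rcases h with h | h <;> linarith [h.1]
  rw [memLp_jacobiMeasure_iff hp measurable_logSingular.aestronglyMeasurable]
  obtain ⟨m, hm, hle⟩ : ∃ m : ℝ → ℝ, IntegrableOn m (Ioo 0 1) ∧ ∀ x ∈ Ioo (0 : ℝ) 1,
      (1 - x) ^ α * ((1 - x)⁻¹ * (1 - Real.log (1 - x))⁻¹) ^ p ≤ m x := by
    rcases h with ⟨hp1, hα⟩ | ⟨rfl, hα⟩
    · refine ⟨_, integrableOn_log_rpow hp1, fun x hx => ?_⟩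
      have h1 : 0 < 1 - x := by linarith [hx.2]
      have h2 := one_le_one_sub_log hx.1.le hx.2
      rw [Real.mul_rpow (by positivity) (by positivity), ← mul_assoc, Real.inv_rpow h1.le,
        Real.inv_rpow (by linarith), ← Real.rpow_neg h1.le,
        ← Real.rpow_neg (zero_le_one.trans h2), ← Real.rpow_add h1]
      refine mul_le_mul_of_nonneg_right ?_ (by positivity)
      rw [← Real.rpow_neg_one]
      exact Real.rpow_le_rpow_of_exponent_ge h1 (by linarith [hx.1]) (by linarith)
    · refine ⟨_, integrableOn_one_sub_rpow (α := α - 1) (by linarith), fun x hx => ?_⟩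
      have h1 : 0 < 1 - x := by linarith [hx.2]
      have h2 := one_le_one_sub_log hx.1.le hx.2
      rw [Real.rpow_one, Real.rpow_sub_one h1.ne', div_eq_mul_inv]
      refine mul_le_mul_of_nonneg_left ?_ (by positivity)
      exact mul_le_of_le_one_right (by positivity) (inv_le_one_of_one_le₀ h2)
  have hm' : IntegrableOn ((Ioo (0 : ℝ) 1).indicator fun x => 2 ^ |β| * m x) (Ioo (-1) 1) :=
    ((integrable_indicator_iff measurableSet_Ioo).2 (hm.const_mul (2 ^ |β|))).integrableOn
  refine hm'.mono' ?_ ?_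
  · have := measurable_logSingular
    exact (by fun_prop : Measurable _).aestronglyMeasurable
  · filter_upwards with x
    by_cases hx : x ∈ Ioo (0 : ℝ) 1
    · have h1 : 0 < 1 - x := by linarith [hx.2]
      have h2 := one_le_one_sub_log hx.1.le hx.2
      have h3 : (1 + x) ^ β ≤ 2 ^ |β| :=
        (Real.rpow_le_rpow_of_exponent_le (by linarith [hx.1]) (le_abs_self β)).trans
          (Real.rpow_le_rpow (by linarith [hx.1]) (by linarith [hx.2]) (abs_nonneg β))
      have h4 : 0 ≤ (1 + x) ^ β := Real.rpow_nonneg (by linarith [hx.1]) _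
      rw [indicator_of_mem hx, logSingular, indicator_of_mem hx,
        abs_of_nonneg (mul_nonneg (by positivity) (by positivity)),
        Real.norm_of_nonneg (by positivity), mul_comm (_ ^ α), mul_assoc]
      have h5 : 0 ≤ (1 - x) ^ α * ((1 - x)⁻¹ * (1 - Real.log (1 - x))⁻¹) ^ p := by positivity
      exact mul_le_mul h3 (hle x hx) h5 (by positivity)
    · rw [indicator_of_notMem hx, logSingular, indicator_of_notMem hx]
      simp [Real.zero_rpow (show p ≠ 0 by linarith)]

theorem memLp_comp_neg {p α β : ℝ} (hp : 1 ≤ p) {g : ℝ → ℝ} (hgm : Measurable g)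
    (hg : MemLp g (ENNReal.ofReal p) (jacobiMeasure α β)) :
    MemLp (fun x => g (-x)) (ENNReal.ofReal p) (jacobiMeasure β α) := by
  rw [memLp_jacobiMeasure_iff hp hgm.aestronglyMeasurable] at hg
  refine (memLp_jacobiMeasure_iff hp (hgm.comp measurable_neg).aestronglyMeasurable).2 ?_
  have := ((Measure.measurePreserving_neg (volume : Measure ℝ)).integrableOn_comp_preimage
    (MeasurableEquiv.neg ℝ).measurableEmbedding).2 hg
  simp only [neg_preimage, neg_Ioo, neg_neg] at this
  refine this.congr_fun (fun x _ => ?_) measurableSet_Ioo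
  simp only [Function.comp_apply, sub_neg_eq_add, ← sub_eq_add_neg]
  ring

/-! ### Nonexistence of the derivative at the endpoint -/

/-- By the mean value theorem, slopes at `b` from the left are values of `h'` near `b`, so they
eventually exceed `h'(b) + 1` although they must tend to `h'(b)`. -/
theorem not_differentiableAt_of_tendsto_deriv_atTop {h : ℝ → ℝ} {a b : ℝ} (hab : a < b)
    (hd : ∀ x ∈ Ioo a b, DifferentiableAt ℝ h x)
    (ht : Tendsto (deriv h) (𝓝[<] b) atTop) : ¬ DifferentiableAt ℝ h b := by
  intro hb
  have hslope : Tendsto (slope h b) (𝓝[<] b) (𝓝 (deriv h b)) :=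
    (hasDerivAt_iff_tendsto_slope.1 hb.hasDerivAt).mono_left
      (nhdsWithin_mono _ fun x hx => ne_of_lt hx)
  obtain ⟨c, hc, hcb⟩ := (mem_nhdsLT_iff_exists_Ioo_subset' hab).1
    (ht.eventually_ge_atTop (deriv h b + 1))
  have hge : ∀ᶠ x in 𝓝[<] b, deriv h b + 1 ≤ slope h b x := by
    filter_upwards [Ioo_mem_nhdsLT (max_lt hc hab)] with x hx
    have hx' := max_lt_iff.1 hx.1
    obtain ⟨ξ, hξ, hξs⟩ := exists_deriv_eq_slope h hx.2
      (fun y hy => by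
        rcases hy.2.lt_or_eq with hlt | rfl
        · exact (hd y ⟨hx'.2.trans_le hy.1, hlt⟩).continuousAt.continuousWithinAt
        · exact hb.continuousAt.continuousWithinAt)
      (fun y hy => (hd y ⟨hx'.2.trans hy.1, hy.2⟩).differentiableWithinAt)
    rw [slope_comm, slope_def_field, ← hξs]
    exact hcb ⟨hx'.1.trans hξ.1, hξ.2⟩
  linarith [ge_of_tendsto hslope hge]

/-- Here `h'(x) = h'(0) + ∫₀ˣ logSingular`, which tends to infinity at `1`. -/
theorem not_differentiableAt_of_deriv_deriv_eq_logSingular {h : ℝ → ℝ}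
    (hd : ∀ x ∈ Ioo (-1 : ℝ) 1, DifferentiableAt ℝ h x)
    (hint : ∀ a b : ℝ, -1 < a → a ≤ b → b < 1 →
      ∫ x in a..b, deriv (deriv h) x = deriv h b - deriv h a)
    (hae : ∀ᵐ x, x ∈ Ioo (-1 : ℝ) 1 → deriv (deriv h) x = logSingular x) :
    ¬ DifferentiableAt ℝ h 1 := by
  refine not_differentiableAt_of_tendsto_deriv_atTop (show (-1 : ℝ) < 1 by norm_num) hd ?_
  refine (tendsto_atTop_add_const_left _ (deriv h 0) tendsto_integral_logSingular).congr' ?_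
  filter_upwards [Ioo_mem_nhdsLT (show (0 : ℝ) < 1 by norm_num)] with x hx
  have := hint 0 x (by norm_num) hx.1.le hx.2
  rw [intervalIntegral.integral_congr_ae (g := logSingular)] at this
  · rw [this]
    ring
  · filter_upwards [hae] with t ht htx
    rw [uIoc_of_le hx.1.le] at htx
    exact ht ⟨by linarith [htx.1], by linarith [htx.2, hx.2]⟩

/-- Apply the previous obstruction to `h = f^{(n)}`. The last node, of index `n + 1`, requires `h`
to be differentiable at `1`; the nodal values play no role. -/
theorem not_wEqU {p α β : ℝ} [Fact (1 ≤ p)] [Fact (-1 < α)] [Fact (-1 < β)]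
    (h : 1 < p ∧ p - 1 ≤ α ∨ p = 1 ∧ 0 < α) (n : ℕ) :
    ¬ WEqU p α β (n + 2) fun _ => 1 := by
  rw [wEqU_iff]
  intro hall
  obtain ⟨f, hf, -, hfg⟩ := hall 0 logSingular (memLp_logSingular β h)
  refine not_differentiableAt_of_deriv_deriv_eq_logSingular (h := iteratedDeriv n f)
    (fun x hx => (hf.diffAt_interior x hx).2) (fun a b ha hab hb => ?_) ?_
    (hf.diffAt_node (Fin.last (n + 1))).2
  · simp only [← iteratedDeriv_succ]
    rw [iteratedDeriv_succ (n := n + 1)]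
    exact (hf.absCont a b ha hab hb).integral_deriv_eq_sub
  · simp only [← iteratedDeriv_succ]
    exact (ae_restrict_iff' measurableSet_Ioo).1 ((restrict_ac_jacobiMeasure α β).ae_eq hfg)

/-- The reflection `x ↦ -x` exchanges the endpoints and the two exponents. The sign appears twice in
the second derivative and cancels, so the obstruction at `1` applies to `x ↦ f^{(n)}(-x)`. -/
theorem not_wEqU' {p α β : ℝ} [hp : Fact (1 ≤ p)] [Fact (-1 < α)] [Fact (-1 < β)]
    (h : 1 < p ∧ p - 1 ≤ β ∨ p = 1 ∧ 0 < β) (n : ℕ) :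
    ¬ WEqU p α β (n + 2) fun _ => -1 := by
  rw [wEqU_iff]
  intro hall
  obtain ⟨f, hf, -, hfg⟩ := hall 0 _
    (memLp_comp_neg hp.out measurable_logSingular (memLp_logSingular α h))
  have hd1 : deriv (fun x => iteratedDeriv n f (-x)) = fun x => -iteratedDeriv (n + 1) f (-x) := by
    funext x
    rw [deriv_comp_neg, iteratedDeriv_succ]
  have hd2 : deriv (deriv fun x => iteratedDeriv n f (-x)) =
      fun x => iteratedDeriv (n + 2) f (-x) := by
    funext x
    rw [hd1, deriv.fun_neg, deriv_comp_neg, neg_neg, iteratedDeriv_succ (n := n + 1)]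
  refine not_differentiableAt_of_deriv_deriv_eq_logSingular
    (h := fun x => iteratedDeriv n f (-x))
    (fun x hx => ?_) (fun a b ha hab hb => ?_) ?_ ?_
  · exact (hf.diffAt_interior (-x) ⟨by linarith [hx.2], by linarith [hx.1]⟩).2.comp x
      differentiableAt_id.neg
  · rw [hd2, hd1, intervalIntegral.integral_comp_neg, iteratedDeriv_succ (n := n + 1)]
    have hac : AbsolutelyContinuousOnInterval (iteratedDeriv (n + 1) f) (-b) (-a) :=
      hf.absCont (-b) (-a) (by linarith) (by linarith) (by linarith)
    rw [hac.integral_deriv_eq_sub]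
    ring
  · have h1 := (ae_restrict_iff' measurableSet_Ioo).1 ((restrict_ac_jacobiMeasure α β).ae_eq hfg)
    have h2 := (Measure.measurePreserving_neg (volume : Measure ℝ)).quasiMeasurePreserving.ae h1
    filter_upwards [h2] with x hx hx1
    rw [hd2]
    simpa using hx ⟨by linarith [hx1.2], by linarith [hx1.1]⟩
  · have := (hf.diffAt_node (Fin.last (n + 1))).2
    exact DifferentiableAt.comp (1 : ℝ) (f := fun x : ℝ => -x) (g := iteratedDeriv n f)
      this differentiableAt_id.neg

end

end JacobiSobolev

/-! ### The three cases -/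

theorem mainTheorem3 (p α β : ℝ) [Fact (1 ≤ p)] [Fact (-1 < α)] [Fact (-1 < β)] :
    (∀ ω : Fin 1 → ℝ, JacobiSobolev.WEqU p α β 1 ω) ∧
    (∀ ℓ : ℕ, 2 ≤ ℓ → 1 < p →
      ((∀ ω : Fin ℓ → ℝ, JacobiSobolev.WEqU p α β ℓ ω) ↔
        α ∈ Set.Ioo (-1) (p - 1) ∧ β ∈ Set.Ioo (-1) (p - 1))) ∧
    (∀ ℓ : ℕ, 2 ≤ ℓ → p = 1 →
      ((∀ ω : Fin ℓ → ℝ, JacobiSobolev.WEqU p α β ℓ ω) ↔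
        α ∈ Set.Ioc (-1) 0 ∧ β ∈ Set.Ioc (-1) 0)) := by
  have hp : 1 ≤ p := Fact.out
  have hα : -1 < α := Fact.out
  have hβ : -1 < β := Fact.out
  refine ⟨fun ω => ?_, fun ℓ hℓ hp1 => ?_, fun ℓ hℓ hp1 => ?_⟩
  · exact (JacobiSobolev.wEqU_iff p α β 1 ω).2 fun c g hg =>
      JacobiSobolev.exists_isSuitable_one hp ω c hg
  · obtain ⟨n, rfl⟩ := Nat.exists_eq_add_of_le' hℓ
    constructor
    · intro hall
      refine ⟨⟨hα, ?_⟩, ⟨hβ, ?_⟩⟩ <;> by_contra! hge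
      · exact JacobiSobolev.not_wEqU (Or.inl ⟨hp1, hge⟩) n (hall _)
      · exact JacobiSobolev.not_wEqU' (Or.inl ⟨hp1, hge⟩) n (hall _)
    · rintro ⟨h1, h2⟩ ω
      exact (JacobiSobolev.wEqU_iff p α β (n + 2) ω).2 fun c g hg =>
        JacobiSobolev.exists_isSuitable_of_integrableOn ω c hg
          (JacobiSobolev.integrableOn_Ioo_of_lt hp1 h1.2 h2.2 hg)
  · obtain ⟨n, rfl⟩ := Nat.exists_eq_add_of_le' hℓ
    constructor
    · intro hall
      refine ⟨⟨hα, ?_⟩, ⟨hβ, ?_⟩⟩ <;> by_contra! hge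
      · exact JacobiSobolev.not_wEqU (Or.inr ⟨hp1, hge⟩) n (hall _)
      · exact JacobiSobolev.not_wEqU' (Or.inr ⟨hp1, hge⟩) n (hall _)
    · rintro ⟨h1, h2⟩ ω
      exact (JacobiSobolev.wEqU_iff p α β (n + 2) ω).2 fun c g hg =>
        JacobiSobolev.exists_isSuitable_of_integrableOn ω c hg
          (JacobiSobolev.integrableOn_Ioo_of_nonpos hp h1.2 h2.2 hg)
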